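/- Let $\mathcal A=\mathbb Q\langle x,y\rangle$ be the noncommutative polynomial algebra. Let $\mathcal H$ be the Connes–Kreimer algebra of rooted trees: the $\mathbb Q$-vector space freely generated by rooted forests (finite multisets of non-plane rooted trees), with the commutative product given by the union of forests; its unit is the empty forest $\mathbb I$. Let $B_+:\mathcal H\to\mathcal H$ be the linear map that grafts all roots of a forest on a common new root, so that $\bullet=B_+(\mathbb I)$ is the one-vertex tree. The coproduct $\Delta:\mathcal H\to\mathcal H\otimes\mathcal H$ is the algebra homomorphism with $\Delta(t)=\mathbb I\otimes t+(B_+\otimes\mathrm{id})\Delta(f)$ for every tree $t=B_+(f)$, $f$ a forest; write $\Delta(f)=\sum_{(f)}f'\otimes f''$. Let $L_u$ denote left multiplication by $u\in\mathcal A$; the operator $L_yL_{x+2y}L_y^{-1}$ is defined on $y\mathcal A$ by $yv\mapsto y(x+2y)v$. The rooted tree maps are the linear maps $\tilde f:\mathcal A\to\mathcal A$, depending linearly on $f\in\mathcal H$, that are uniquely determined by the following rules: (1) $\tilde{\mathbb I}=\mathrm{id}$; (2) $\tilde\bullet(x)=yx$ and $\tilde\bullet(y)=-yx$; (3) $\tilde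 t(u)=L_yL_{x+2y}L_y^{-1}\tilde f(u)$ for $u\in\{x,y\}$ if $t=B_+(f)$ with a forest $f\neq\mathbb I$ (then $\tilde f(u)\in y\mathcal A$); (4) $\widetilde{gh}=\tilde g\circ\tilde h$ for $g,h\in\mathcal H$; (5) $\tilde f(uw)=\sum_{(f)}\tilde{f'}(u)\,\tilde{f''}(w)$ for $f\in\mathcal H$, $u\in\{x,y\}$ and $w\in\mathcal A$. The product $\diamond$ on $\mathcal A$ is the $\mathbb Q$-bilinear product with $w\diamond1=1\diamond w=w$ and $$\begin{aligned} xw_1\diamond xw_2&=x(w_1\diamond xw_2)-x(yw_1\diamond w_2),\\ xw_1\diamond yw_2&=x(w_1\diamond yw_2)+y(xw_1\diamond w_2),\\ yw_1\diamond xw_2&=y(w_1\diamond xw_2)+x(yw_1\diamond w_2),\\ yw_1\diamond yw_2&=y(w_1\diamond yw_2)-y(xw_1\diamond w_2) \end{aligned}$$ for $w,w_1,w_2\in\mathcal A$. The polynomials $F_f\in\mathcal A$, depending linearly on $f\in\mathcal H$, are uniquely determined by $F_{\mathbb I}=1$; $F_\bullet=y$; $F_{B_+(f)}=L_yL_{x+2y}L_y^{-1}(F_f)$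 for a forest $f\neq\mathbb I$ (then $F_f\in y\mathcal A$); and $F_{gh}=F_g\diamond F_h$ for forests $g,h$. Theorem. For all $f\in\mathcal H$ and $w\in\mathcal A$, $$\tilde f(wx)=(F_f\diamond w)\,x .$$ -/

import Mathlib

namespace RootedTrees

/-- Plane rooted trees: a root together with the list of the subtrees attached to it. -/
inductive PlaneTree : Type
  | node : List PlaneTree → PlaneTree

namespace PlaneTree

/-- Elementary changes of the plane structure: permuting the subtrees attached to the root, or
making such a change inside one of these subtrees. -/
inductive Reorder : PlaneTree → PlaneTree → Prop
  | perm {l m : List PlaneTree} : l.Perm m → Reorder (node l) (node m)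
  | inside {s t : PlaneTree} (l r : List PlaneTree) :
      Reorder s t → Reorder (node (l ++ s :: r)) (node (l ++ t :: r))

theorem induction {P : PlaneTree → Prop} (h : ∀ l, (∀ t ∈ l, P t) → P (node l)) : ∀ t, P t
  | node l => h l (fun t _ => induction h t)

/-- The fold of a plane tree in a monoid: the value at a tree is obtained by `G` from the product
of the values at the subtrees attached to the root. -/
def fold {M : Type*} [Monoid M] (G : M → M) : PlaneTree → M
  | node l => G ((l.map (fold G)).prod)

end PlaneTree

/-- Rooted trees without plane structure. -/
def RootedTree : Type := Quot PlaneTree.Reorder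

/-- Forests: finite collections of rooted trees, with multiplicity and without order. The sum of
multisets is the product of forests, and `0` is the empty forest. -/
abbrev Forest : Type := Multiset RootedTree

/-- The rooted tree underlying a plane tree. -/
def RootedTree.mk (t : PlaneTree) : RootedTree := Quot.mk _ t

/-- A plane tree underlying which is the given rooted tree. -/
noncomputable def RootedTree.out (t : RootedTree) : PlaneTree := Quot.out t

theorem map_mk_map_out (l : List RootedTree) :
    (l.map RootedTree.out).map RootedTree.mk = l := by
  rw [List.map_map]
  refine (List.map_congr_left fun t _ => ?_).trans (List.map_id l)
  exact Quot.out_eq t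

/-- Graft the roots of all trees of a forest on a common new root. -/
noncomputable def graft (f : Forest) : RootedTree :=
  RootedTree.mk (PlaneTree.node (f.toList.map RootedTree.out))

theorem mk_node_eq_aux : ∀ (l m p : List PlaneTree), l.map RootedTree.mk = m.map RootedTree.mk →
    RootedTree.mk (.node (p ++ l)) = RootedTree.mk (.node (p ++ m))
  | [], [], _, _ => rfl
  | [], _ :: _, _, h => by simp at h
  | _ :: _, [], _, h => by simp at h
  | s :: l, t :: m, p, h => by
    simp only [List.map_cons, List.cons.injEq] at h
    have h1 : RootedTree.mk (.node (p ++ s :: l)) = RootedTree.mk (.node (p ++ t :: l)) := by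
      have h2 := Quot.eqvGen_exact h.1
      clear h
      induction h2 with
      | rel a b hab => exact Quot.sound (.inside p l hab)
      | refl a => rfl
      | symm a b _ ih => exact ih.symm
      | trans a b c _ _ ih1 ih2 => exact ih1.trans ih2
    rw [h1]
    simpa using mk_node_eq_aux l m (p ++ [t]) h.2

theorem mk_node (l : List PlaneTree) :
    RootedTree.mk (.node l) = graft (l.map RootedTree.mk : List RootedTree) := by
  have hp : (Multiset.toList ((l.map RootedTree.mk : List RootedTree) : Forest)).Perm
      (l.map RootedTree.mk) := by
    rw [← Multiset.coe_eq_coe, Multiset.coe_toList]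
  have h1 : graft (l.map RootedTree.mk : List RootedTree) =
      RootedTree.mk (.node ((l.map RootedTree.mk).map RootedTree.out)) :=
    Quot.sound (.perm (hp.map _))
  rw [h1]
  refine mk_node_eq_aux l _ [] ?_
  rw [map_mk_map_out]

/-- The forest of the subtrees attached to the root. -/
def RootedTree.children : RootedTree → Forest :=
  Quot.lift (fun t => match t with | .node l => ((l.map RootedTree.mk : List RootedTree) : Forest))
    (by
      intro a b h
      cases h with
      | perm h => exact Multiset.coe_eq_coe.2 (h.map _)
      | inside l r h =>
        have : RootedTree.mk _ = RootedTree.mk _ := Quot.sound h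
        simp [this])

theorem children_graft (f : Forest) : (graft f).children = f := by
  change ((List.map RootedTree.mk (f.toList.map RootedTree.out) : List RootedTree) : Forest) = f
  rw [map_mk_map_out, Multiset.coe_toList]

theorem graft_children (t : RootedTree) : graft t.children = t := by
  induction t using Quot.ind with
  | _ t =>
    cases t with
    | node l => exact (mk_node l).symm

theorem graft_bijective : Function.Bijective graft :=
  ⟨Function.LeftInverse.injective children_graft, Function.RightInverse.surjective graft_children⟩

theorem Forest.induction {P : Forest → Prop} (h0 : P 0) (hg : ∀ f, P f → P {graft f})
    (hadd : ∀ f g, P f → P g → P (f + g)) (f : Forest) : P f := by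
  have ht : ∀ t : PlaneTree, P {RootedTree.mk t} := by
    intro t
    induction t using PlaneTree.induction with
    | h l ih =>
      rw [mk_node]
      apply hg
      induction l with
      | nil => exact h0
      | cons a l ihl =>
        rw [List.map_cons, ← Multiset.cons_coe, ← Multiset.singleton_add]
        exact hadd _ _ (ih a (by simp)) (ihl fun t ht => ih t (by simp [ht]))
  induction f using Multiset.induction with
  | empty => exact h0
  | cons a f ihf =>
    rw [← Multiset.singleton_add]
    refine hadd _ _ ?_ ihf
    obtain ⟨t, rfl⟩ := Quot.exists_rep a
    exact ht t

theorem exists_fold {M : Type*} [Monoid M] (G : M → M)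
    (hc : ∀ s t : PlaneTree, Commute (PlaneTree.fold G s) (PlaneTree.fold G t)) :
    ∃ φ : Multiplicative Forest →* M, ∀ f : Forest,
      φ (.ofAdd {graft f}) = G (φ (.ofAdd f)) := by
  have hr : ∀ s t, PlaneTree.Reorder s t → PlaneTree.fold G s = PlaneTree.fold G t := by
    intro s t h
    induction h with
    | @perm l m h =>
      rw [PlaneTree.fold, PlaneTree.fold]
      congr 1
      refine List.Perm.prod_eq' (h.map _) ?_
      rw [List.pairwise_map]
      exact List.pairwise_of_forall fun a b => hc a b
    | inside l r h ih => simp [PlaneTree.fold, ih]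
  let ψ : RootedTree → M := Quot.lift (PlaneTree.fold G) hr
  have hψ : ∀ a b, Commute (ψ a) (ψ b) := fun a b =>
    Quot.induction_on₂ a b hc
  have hψ' : ∀ f : Forest, {x | x ∈ f.map ψ}.Pairwise Commute := by
    intro f x hx y hy _
    obtain ⟨a, _, rfl⟩ := Multiset.mem_map.1 hx
    obtain ⟨b, _, rfl⟩ := Multiset.mem_map.1 hy
    exact hψ a b
  let φ : Multiplicative Forest →* M :=
    { toFun := fun f => (f.toAdd.map ψ).noncommProd (hψ' _)
      map_one' := by simp
      map_mul' := fun f g => by simp only [toAdd_mul, Multiset.map_add, Multiset.noncommProd_add] }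
  have hφ : ∀ l : List PlaneTree, φ (.ofAdd ((l.map RootedTree.mk : List RootedTree) : Forest)) =
      (l.map (PlaneTree.fold G)).prod := by
    intro l
    change (((l.map RootedTree.mk : List RootedTree) : Forest).map ψ).noncommProd (hψ' _) = _
    simp only [Multiset.map_coe, List.map_map, Multiset.noncommProd_coe]
    rfl
  refine ⟨φ, fun f => ?_⟩
  obtain ⟨l, rfl⟩ : ∃ l : List PlaneTree, f = (l.map RootedTree.mk : List RootedTree) :=
    ⟨f.toList.map RootedTree.out, (children_graft f).symm⟩
  rw [← mk_node, hφ]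
  refine (hφ [.node l]).trans ?_
  rw [List.map_singleton, List.prod_singleton, PlaneTree.fold]

open scoped TensorProduct

/-- The Connes–Kreimer algebra: the `ℚ`-vector space freely generated by the rooted forests, with
the commutative product given by the product of forests. -/
abbrev CK : Type := AddMonoidAlgebra ℚ Forest

/-- A forest as a basis element of the Connes–Kreimer algebra. -/
noncomputable def ofForest (f : Forest) : CK := AddMonoidAlgebra.single f 1

theorem ofForest_zero : ofForest 0 = 1 := rfl

theorem ofForest_add (f g : Forest) : ofForest (f + g) = ofForest f * ofForest g := by
  simp [ofForest, AddMonoidAlgebra.single_mul_single]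

/-- The linear map `B₊`: on a forest, graft all roots on a common new root. -/
noncomputable def Bplus : CK →ₗ[ℚ] CK :=
  AddMonoidAlgebra.mapDomainLinearMap ℚ ℚ (fun f : Forest => ({graft f} : Forest))

theorem Bplus_ofForest (f : Forest) : Bplus (ofForest f) = ofForest {graft f} :=
  AddMonoidAlgebra.mapDomainLinearMap_single _ _ _

theorem linearMap_ext_forest {V : Type*} [AddCommGroup V] [Module ℚ V] {φ ψ : CK →ₗ[ℚ] V}
    (h : ∀ f, φ (ofForest f) = ψ (ofForest f)) : φ = ψ := by
  refine LinearMap.ext fun a => ?_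
  induction a using AddMonoidAlgebra.induction_linear with
  | zero => simp
  | add a b ha hb => simp [ha, hb]
  | single f r =>
    have : AddMonoidAlgebra.single f r = r • ofForest f := by
      simp [ofForest]
    rw [this, map_smul, map_smul, h]

/-- The recursive rule of the coproduct on a tree `t = B₊(f)`, for an algebra homomorphism:
`Δ(t) = 1 ⊗ t + (B₊ ⊗ id)(Δ(f))`. -/
def IsCoproduct (D : CK →ₐ[ℚ] CK ⊗[ℚ] CK) : Prop :=
  ∀ f : Forest, D (ofForest {graft f}) =
    1 ⊗ₜ[ℚ] ofForest {graft f} + TensorProduct.map Bplus LinearMap.id (D (ofForest f))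

theorem existsUnique_coproduct : ∃! D : CK →ₐ[ℚ] CK ⊗[ℚ] CK, IsCoproduct D := by
  obtain ⟨φ, hφ⟩ := exists_fold (M := CK × (CK ⊗[ℚ] CK))
    (fun p => (Bplus p.1, 1 ⊗ₜ[ℚ] Bplus p.1 + TensorProduct.map Bplus LinearMap.id p.2))
    (fun _ _ => Commute.all _ _)
  have h1 : ∀ f : Forest, (φ (.ofAdd f)).1 = ofForest f := by
    intro f
    induction f using Forest.induction with
    | h0 => rw [ofAdd_zero, map_one]; rfl
    | hg f ih => rw [hφ, ih, Bplus_ofForest]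
    | hadd f g hf hg => rw [ofAdd_add, map_mul, Prod.fst_mul, hf, hg, ofForest_add]
  refine ⟨AddMonoidAlgebra.lift ℚ _ _ ((MonoidHom.snd _ _).comp φ), ?_, ?_⟩
  · intro f
    have : ∀ f : Forest, (AddMonoidAlgebra.lift ℚ (CK ⊗[ℚ] CK) Forest
        ((MonoidHom.snd _ _).comp φ)) (ofForest f) = (φ (.ofAdd f)).2 := fun f => by
      simp [ofForest, AddMonoidAlgebra.lift_single]
    rw [this, this, hφ, h1, Bplus_ofForest]
  · intro D hD
    have key : ∀ f : Forest, D (ofForest f) = (φ (.ofAdd f)).2 := by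
      intro f
      induction f using Forest.induction with
      | h0 => rw [ofAdd_zero, map_one, ofForest_zero, map_one]; rfl
      | hg f ih => rw [hφ, hD, h1, ih, Bplus_ofForest]
      | hadd f g hf hg => rw [ofAdd_add, map_mul, ofForest_add, map_mul, Prod.snd_mul, hf, hg]
    apply AlgHom.toLinearMap_injective
    apply linearMap_ext_forest
    intro f
    refine (key f).trans ?_
    simp [ofForest, AddMonoidAlgebra.lift_single]

/-- The coproduct `Δ` of the Connes–Kreimer Hopf algebra. -/
noncomputable def coproduct : CK →ₐ[ℚ] CK ⊗[ℚ] CK := existsUnique_coproduct.choose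

theorem isCoproduct_coproduct : IsCoproduct coproduct := existsUnique_coproduct.choose_spec.1


/-- The two indeterminates. -/
inductive Letter : Type
  | x
  | y

/-- The noncommutative polynomial algebra `ℚ⟨x, y⟩`. -/
abbrev NCPoly : Type := FreeAlgebra ℚ Letter

/-- The indeterminate `x`. -/
noncomputable def X : NCPoly := FreeAlgebra.ι ℚ Letter.x

/-- The indeterminate `y`. -/
noncomputable def Y : NCPoly := FreeAlgebra.ι ℚ Letter.y

/-- The word with the given list of letters. -/
noncomputable def word (l : List Letter) : NCPoly := (l.map (FreeAlgebra.ι ℚ)).prod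

theorem word_nil : word [] = 1 := rfl

theorem word_x (l : List Letter) : word (.x :: l) = X * word l := by
  simp [word, X]

theorem word_y (l : List Letter) : word (.y :: l) = Y * word l := by
  simp [word, Y]

/-- The words form a basis. -/
noncomputable def wordBasis : Module.Basis (List Letter) ℚ NCPoly :=
  (FreeAlgebra.basisFreeMonoid ℚ Letter).reindex FreeMonoid.toList

theorem wordBasis_apply (l : List Letter) : wordBasis l = word l := by
  rw [wordBasis, Module.Basis.reindex_apply, FreeAlgebra.basisFreeMonoid]
  simp [FreeAlgebra.equivMonoidAlgebraFreeMonoid, word, FreeMonoid.lift_apply]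

theorem linearMap_ext_word {V : Type*} [AddCommGroup V] [Module ℚ V] {φ ψ : NCPoly →ₗ[ℚ] V}
    (h : ∀ l, φ (word l) = ψ (word l)) : φ = ψ :=
  wordBasis.ext fun l => by rw [wordBasis_apply, h]

/-- The linear map with given values on words. -/
noncomputable def onWords {V : Type*} [AddCommGroup V] [Module ℚ V] (v : List Letter → V) :
    NCPoly →ₗ[ℚ] V :=
  wordBasis.constr ℚ v

theorem onWords_word {V : Type*} [AddCommGroup V] [Module ℚ V] (v : List Letter → V)
    (l : List Letter) : onWords v (word l) = v l := by
  rw [onWords, ← wordBasis_apply, Module.Basis.constr_basis]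

/-- The product `⋄` on words, by recursion on the total length. -/
noncomputable def diamondWord : List Letter → List Letter → NCPoly
  | [], v => word v
  | u, [] => word u
  | .x :: u, .x :: v => X * diamondWord u (.x :: v) - X * diamondWord (.y :: u) v
  | .x :: u, .y :: v => X * diamondWord u (.y :: v) + Y * diamondWord (.x :: u) v
  | .y :: u, .x :: v => Y * diamondWord u (.x :: v) + X * diamondWord (.y :: u) v
  | .y :: u, .y :: v => Y * diamondWord u (.y :: v) - Y * diamondWord (.x :: u) v
termination_by u v => u.length + v.length

/-- The product `⋄` on `ℚ⟨x, y⟩`. -/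
noncomputable def diamond : NCPoly →ₗ[ℚ] NCPoly →ₗ[ℚ] NCPoly :=
  onWords fun u => onWords fun v => diamondWord u v

theorem diamond_word (u v : List Letter) : diamond (word u) (word v) = diamondWord u v := by
  rw [diamond, onWords_word, onWords_word]

theorem bilinear_ext_word {V : Type*} [AddCommGroup V] [Module ℚ V]
    {φ ψ : NCPoly →ₗ[ℚ] NCPoly →ₗ[ℚ] V}
    (h : ∀ u v, φ (word u) (word v) = ψ (word u) (word v)) (a b : NCPoly) : φ a b = ψ a b := by
  have : φ = ψ := linearMap_ext_word fun u => linearMap_ext_word fun v => h u v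
  rw [this]

theorem one_diamond (a : NCPoly) : diamond 1 a = a := by
  have : diamond 1 = LinearMap.id := linearMap_ext_word fun v => by
    rw [← word_nil, diamond_word, diamondWord]; rfl
  rw [this]; rfl

theorem diamond_one (a : NCPoly) : diamond a 1 = a := by
  have : diamond.flip 1 = LinearMap.id := linearMap_ext_word fun v => by
    rw [LinearMap.flip_apply, ← word_nil, diamond_word]
    cases v <;> rw [diamondWord] <;> simp
  exact congrArg (fun φ => φ a) this

theorem diamond_x_x (a b : NCPoly) :
    diamond (X * a) (X * b) = X * diamond a (X * b) - X * diamond (Y * a) b := by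
  have := bilinear_ext_word (φ := diamond.compl₁₂ (LinearMap.mulLeft ℚ X) (LinearMap.mulLeft ℚ X))
    (ψ := (diamond.compl₂ (LinearMap.mulLeft ℚ X)).compr₂ (LinearMap.mulLeft ℚ X) - (diamond.comp (LinearMap.mulLeft ℚ Y)).compr₂ (LinearMap.mulLeft ℚ X))
    (fun u v => by
      simp only [LinearMap.compl₁₂_apply, LinearMap.sub_apply, LinearMap.compr₂_apply,
        LinearMap.compl₂_apply, LinearMap.comp_apply, LinearMap.mulLeft_apply, ← word_x, ← word_y,
        diamond_word]
      rw [diamondWord]) a b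
  simpa using this

theorem diamond_x_y (a b : NCPoly) :
    diamond (X * a) (Y * b) = X * diamond a (Y * b) + Y * diamond (X * a) b := by
  have := bilinear_ext_word (φ := diamond.compl₁₂ (LinearMap.mulLeft ℚ X) (LinearMap.mulLeft ℚ Y))
    (ψ := (diamond.compl₂ (LinearMap.mulLeft ℚ Y)).compr₂ (LinearMap.mulLeft ℚ X) + (diamond.comp (LinearMap.mulLeft ℚ X)).compr₂ (LinearMap.mulLeft ℚ Y))
    (fun u v => by
      simp only [LinearMap.compl₁₂_apply, LinearMap.add_apply, LinearMap.compr₂_apply,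
        LinearMap.compl₂_apply, LinearMap.comp_apply, LinearMap.mulLeft_apply, ← word_x, ← word_y,
        diamond_word]
      rw [diamondWord]) a b
  simpa using this

theorem diamond_y_x (a b : NCPoly) :
    diamond (Y * a) (X * b) = Y * diamond a (X * b) + X * diamond (Y * a) b := by
  have := bilinear_ext_word (φ := diamond.compl₁₂ (LinearMap.mulLeft ℚ Y) (LinearMap.mulLeft ℚ X))
    (ψ := (diamond.compl₂ (LinearMap.mulLeft ℚ X)).compr₂ (LinearMap.mulLeft ℚ Y) + (diamond.comp (LinearMap.mulLeft ℚ Y)).compr₂ (LinearMap.mulLeft ℚ X))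
    (fun u v => by
      simp only [LinearMap.compl₁₂_apply, LinearMap.add_apply, LinearMap.compr₂_apply,
        LinearMap.compl₂_apply, LinearMap.comp_apply, LinearMap.mulLeft_apply, ← word_x, ← word_y,
        diamond_word]
      rw [diamondWord]) a b
  simpa using this

theorem diamond_y_y (a b : NCPoly) :
    diamond (Y * a) (Y * b) = Y * diamond a (Y * b) - Y * diamond (X * a) b := by
  have := bilinear_ext_word (φ := diamond.compl₁₂ (LinearMap.mulLeft ℚ Y) (LinearMap.mulLeft ℚ Y))
    (ψ := (diamond.compl₂ (LinearMap.mulLeft ℚ Y)).compr₂ (LinearMap.mulLeft ℚ Y) - (diamond.comp (LinearMap.mulLeft ℚ X)).compr₂ (LinearMap.mulLeft ℚ Y))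
    (fun u v => by
      simp only [LinearMap.compl₁₂_apply, LinearMap.sub_apply, LinearMap.compr₂_apply,
        LinearMap.compl₂_apply, LinearMap.comp_apply, LinearMap.mulLeft_apply, ← word_x, ← word_y,
        diamond_word]
      rw [diamondWord]) a b
  simpa using this

theorem word_induction {P : NCPoly → Prop} (h1 : P 1) (hadd : ∀ a b, P a → P b → P (a + b))
    (hsmul : ∀ (c : ℚ) a, P a → P (c • a)) (hz : ∀ a, P a → P ((X + Y) * a))
    (hx : ∀ a, P a → P (X * a)) (a : NCPoly) : P a := by
  have hw : ∀ l, P (word l) := by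
    intro l
    induction l with
    | nil => exact h1
    | cons s l ih =>
      cases s with
      | x => rw [word_x]; exact hx _ ih
      | y =>
        have : Y * word l = (X + Y) * word l + (-1 : ℚ) • (X * word l) := by
          rw [add_mul, neg_smul, one_smul]; abel
        rw [word_y, this]
        exact hadd _ _ (hz _ ih) (hsmul _ _ (hx _ ih))
  have ha : a ∈ Submodule.span ℚ (Set.range word) := by
    have : (wordBasis : List Letter → NCPoly) = word := funext wordBasis_apply
    rw [← this, wordBasis.span_eq]
    trivial
  have h0 : P 0 := by simpa using hsmul 0 1 h1
  induction ha using Submodule.span_induction with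
  | mem _ h => obtain ⟨l, rfl⟩ := h; exact hw l
  | zero => exact h0
  | add a b _ _ ha hb => exact hadd _ _ ha hb
  | smul c a _ ha => exact hsmul _ _ ha

theorem z_diamond (a b : NCPoly) : diamond ((X + Y) * a) b = (X + Y) * diamond a b := by
  induction b using word_induction with
  | h1 => rw [diamond_one, diamond_one]
  | hadd b c hb hc => rw [map_add, map_add, hb, hc, mul_add]
  | hsmul c b hb => rw [map_smul, map_smul, hb, mul_smul_comm]
  | hz b _ =>
    simp only [add_mul, map_add, LinearMap.add_apply, diamond_x_x, diamond_x_y, diamond_y_x,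
      diamond_y_y, mul_add]
    abel
  | hx b _ =>
    simp only [add_mul, map_add, LinearMap.add_apply, diamond_x_x, diamond_y_x]
    abel

theorem y_diamond (a b : NCPoly) :
    diamond (Y * a) b = (X + Y) * diamond a b - diamond (X * a) b := by
  rw [← z_diamond, add_mul, map_add, LinearMap.add_apply]
  abel

theorem diamond_z (a b : NCPoly) : diamond a ((X + Y) * b) = (X + Y) * diamond a b := by
  induction a using word_induction with
  | h1 => rw [one_diamond, one_diamond]
  | hadd a c ha hc => simp only [map_add, LinearMap.add_apply, ha, hc, mul_add]
  | hsmul c a ha => simp only [map_smul, LinearMap.smul_apply, ha, mul_smul_comm]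
  | hz a ha => rw [z_diamond, z_diamond, ha]
  | hx a ha =>
    have h : diamond (X * a) ((X + Y) * b) =
        X * diamond a ((X + Y) * b) - X * diamond (Y * a) b + Y * diamond (X * a) b := by
      simp only [add_mul, map_add, diamond_x_x, diamond_x_y, mul_add]
      abel
    rw [h, ha, y_diamond]
    simp only [add_mul, mul_add, mul_sub]
    abel

theorem diamond_x_x' (a b : NCPoly) : diamond (X * a) (X * b) =
    X * (diamond a (X * b) + diamond (X * a) b - (X + Y) * diamond a b) := by
  rw [diamond_x_x, y_diamond, ← mul_sub]
  congr 1
  abel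

theorem diamond_comm (a b : NCPoly) : diamond a b = diamond b a := by
  induction a using word_induction generalizing b with
  | h1 => rw [one_diamond, diamond_one]
  | hadd a c ha hc => rw [map_add, map_add, LinearMap.add_apply, ha, hc]
  | hsmul c a ha => rw [map_smul, map_smul, LinearMap.smul_apply, ha]
  | hz a ha => rw [z_diamond, diamond_z, ha]
  | hx a ha =>
    induction b using word_induction with
    | h1 => rw [one_diamond, diamond_one]
    | hadd b c hb hc => rw [map_add, map_add, LinearMap.add_apply, hb, hc]
    | hsmul c b hb => rw [map_smul, map_smul, LinearMap.smul_apply, hb]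
    | hz b hb => rw [z_diamond, diamond_z, hb]
    | hx b hb =>
      rw [diamond_x_x', diamond_x_x', ha, hb, ha b, add_comm (diamond _ a)]

theorem diamond_assoc (a b c : NCPoly) :
    diamond (diamond a b) c = diamond a (diamond b c) := by
  induction a using word_induction generalizing b c with
  | h1 => simp only [one_diamond]
  | hadd a d ha hd => simp only [map_add, LinearMap.add_apply, ha, hd]
  | hsmul r a ha => simp only [map_smul, LinearMap.smul_apply, ha]
  | hz a ha => simp only [z_diamond, ha]
  | hx a ha =>
    induction b using word_induction generalizing c with
    | h1 => simp only [one_diamond, diamond_one]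
    | hadd b d hb hd => simp only [map_add, LinearMap.add_apply, hb, hd]
    | hsmul r b hb => simp only [map_smul, LinearMap.smul_apply, hb]
    | hz b hb => simp only [z_diamond, diamond_z, hb]
    | hx b hb =>
      induction c using word_induction with
      | h1 => simp only [diamond_one]
      | hadd c d hc hd => simp only [map_add, hc, hd]
      | hsmul r c hc => simp only [map_smul, hc]
      | hz c hc => simp only [diamond_z, hc]
      | hx c hc =>
        rw [diamond_x_x' a b, diamond_x_x', ← diamond_x_x' a b, hc, diamond_x_x' b c,
          diamond_x_x' a, ← diamond_x_x' b c]
        simp only [map_add, map_sub, LinearMap.add_apply, LinearMap.sub_apply, z_diamond,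
          diamond_z, ha, hb, mul_add, mul_sub]
        abel

/-- `yℚ⟨x, y⟩` is closed under `⋄`. -/
theorem diamond_mem_y (a b : NCPoly) : ∃ c, diamond (Y * a) (Y * b) = Y * c :=
  ⟨_, by rw [diamond_y_y, ← mul_sub]⟩


theorem ofForest_induction {P : CK → Prop} (hf : ∀ f, P (ofForest f))
    (hadd : ∀ a b, P a → P b → P (a + b)) (hsmul : ∀ (c : ℚ) a, P a → P (c • a)) (h : CK) :
    P h := by
  induction h using AddMonoidAlgebra.induction_linear with
  | zero => simpa using hsmul 0 _ (hf 0)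
  | add a b ha hb => exact hadd _ _ ha hb
  | single f r =>
    have : AddMonoidAlgebra.single f r = r • ofForest f := by simp [ofForest]
    rw [this]
    exact hsmul _ _ (hf f)

/-- The recursive rules of the polynomials `F_f`, where `f ↦ F_f` is linear. The operator
`L_y L_{x+2y} L_y⁻¹` is only applied to elements of `yℚ⟨x, y⟩`; it maps `y v` to `y (x + 2 y) v`. -/
structure IsTreePolynomial (F : CK →ₗ[ℚ] NCPoly) : Prop where
  empty : F (ofForest 0) = 1
  single : F (ofForest {graft 0}) = Y
  graft : ∀ f : Forest, f ≠ 0 → ∃ v : NCPoly,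
    F (ofForest f) = Y * v ∧ F (ofForest {graft f}) = Y * ((X + 2 * Y) * v)
  mul : ∀ g h : Forest, F (ofForest (g + h)) = diamond (F (ofForest g)) (F (ofForest h))

/-- Auxiliary operator: `1 ↦ y`, `y v ↦ y (x + 2 y) v`, `x v ↦ 0`. -/
noncomputable def polyGraft : NCPoly →ₗ[ℚ] NCPoly :=
  onWords fun l => match l with
    | [] => Y
    | .x :: _ => 0
    | .y :: l => Y * ((X + 2 * Y) * word l)

theorem polyGraft_one : polyGraft 1 = Y := by
  rw [polyGraft, ← word_nil, onWords_word]

theorem polyGraft_y (a : NCPoly) : polyGraft (Y * a) = Y * ((X + 2 * Y) * a) := by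
  have : polyGraft ∘ₗ LinearMap.mulLeft ℚ Y = LinearMap.mulLeft ℚ Y ∘ₗ LinearMap.mulLeft ℚ (X + 2 * Y) := linearMap_ext_word fun l => by
    simp only [LinearMap.comp_apply, LinearMap.mulLeft_apply, ← word_y]
    rw [polyGraft, onWords_word]
  exact congrArg (fun φ => φ a) this

theorem existsUnique_treePolynomial : ∃! F : CK →ₗ[ℚ] NCPoly, IsTreePolynomial F := by
  obtain ⟨φ, hφ⟩ := exists_fold (M := Module.End ℚ NCPoly)
    (fun p => diamond (polyGraft (p 1)))
    (by
      intro s t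
      cases s with | node l =>
      cases t with | node m =>
      rw [PlaneTree.fold, PlaneTree.fold]
      refine LinearMap.ext fun a => ?_
      simp only [Module.End.mul_apply]
      rw [← diamond_assoc, ← diamond_assoc, diamond_comm (polyGraft _)])
  have h1 : ∀ f : Forest, φ (.ofAdd f) = diamond (φ (.ofAdd f) 1) := by
    intro f
    induction f using Forest.induction with
    | h0 =>
      rw [ofAdd_zero, map_one]
      refine LinearMap.ext fun a => ?_
      simp [one_diamond]
    | hg f ih => rw [hφ, diamond_one]
    | hadd f g hf hg =>
      rw [ofAdd_add, map_mul, hf, hg]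
      refine LinearMap.ext fun a => ?_
      simp only [Module.End.mul_apply, diamond_one, diamond_assoc]
  let F : CK →ₗ[ℚ] NCPoly := (LinearMap.applyₗ (R := ℚ) (1 : NCPoly)) ∘ₗ
    (AddMonoidAlgebra.lift ℚ (Module.End ℚ NCPoly) Forest φ).toLinearMap
  have hF : ∀ f, F (ofForest f) = φ (.ofAdd f) 1 := fun f => by
    simp [F, ofForest, AddMonoidAlgebra.lift_single]
  have hempty : F (ofForest 0) = 1 := by
    rw [hF, ofAdd_zero]
    exact congrArg (fun ψ : Module.End ℚ NCPoly => ψ 1) (map_one φ)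
  have htree : ∀ f, F (ofForest {graft f}) = polyGraft (F (ofForest f)) := by
    intro f
    rw [hF, hφ, diamond_one, hF]
  have hmul : ∀ g h : Forest,
      F (ofForest (g + h)) = diamond (F (ofForest g)) (F (ofForest h)) := by
    intro g h
    rw [hF, ofAdd_add, map_mul, Module.End.mul_apply, h1 g, ← hF, ← hF]
  have hy : ∀ f : Forest, f ≠ 0 → ∃ v, F (ofForest f) = Y * v := by
    intro f
    induction f using Forest.induction with
    | h0 => intro h; exact absurd rfl h
    | hg f ih =>
      intro _
      rw [htree]
      by_cases hf : f = 0
      · exact ⟨1, by rw [hf, hempty, polyGraft_one, mul_one]⟩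
      · obtain ⟨v, hv⟩ := ih hf
        exact ⟨_, by rw [hv, polyGraft_y]⟩
    | hadd f g hf hg =>
      intro hfg
      by_cases hf0 : f = 0
      · by_cases hg0 : g = 0
        · exact absurd (by rw [hf0, hg0, add_zero]) hfg
        · simpa [hf0] using hg hg0
      · by_cases hg0 : g = 0
        · simpa [hg0] using hf hf0
        · obtain ⟨v, hv⟩ := hf hf0
          obtain ⟨w, hw⟩ := hg hg0
          rw [hmul, hv, hw]
          exact diamond_mem_y v w
  refine ⟨F, ⟨hempty, by rw [htree, hempty, polyGraft_one], ?_, hmul⟩, ?_⟩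
  · intro f hf
    obtain ⟨v, hv⟩ := hy f hf
    exact ⟨v, hv, by rw [htree, hv, polyGraft_y]⟩
  · intro F' h'
    refine linearMap_ext_forest fun f => ?_
    induction f using Forest.induction with
    | h0 => rw [h'.empty, hempty]
    | hg f ih =>
      rw [htree]
      by_cases hf : f = 0
      · rw [hf, h'.single, hempty, polyGraft_one]
      · obtain ⟨v, hv, hv'⟩ := h'.graft f hf
        rw [hv', ← ih, hv, polyGraft_y]
    | hadd f g hf hg => rw [h'.mul, hmul, hf, hg]

/-- The linear map `f ↦ F_f`. -/
noncomputable def treePolynomial : CK →ₗ[ℚ] NCPoly := existsUnique_treePolynomial.choose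

theorem isTreePolynomial_treePolynomial : IsTreePolynomial treePolynomial :=
  existsUnique_treePolynomial.choose_spec.1

/-- The recursive rules of the rooted tree maps `f̃ = T f`, where `f ↦ f̃` is linear. The operator
`L_y L_{x+2y} L_y⁻¹` is only applied to elements of `yℚ⟨x, y⟩`; it maps `y v` to `y (x + 2 y) v`.
In the last rule, `∑ f̃'(u) f̃''(w)` for `Δ(f) = ∑ f' ⊗ f''` is the image of `Δ(f)` under the linear
map with `f' ⊗ f'' ↦ f̃'(u) f̃''(w)`. -/
structure IsRootedTreeMap (T : CK →ₗ[ℚ] NCPoly →ₗ[ℚ] NCPoly) : Prop where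
  empty : T (ofForest 0) = LinearMap.id
  single_x : T (ofForest {graft 0}) X = Y * X
  single_y : T (ofForest {graft 0}) Y = -(Y * X)
  graft : ∀ f : Forest, f ≠ 0 → ∀ u : NCPoly, u = X ∨ u = Y → ∃ v : NCPoly,
    T (ofForest f) u = Y * v ∧ T (ofForest {graft f}) u = Y * ((X + 2 * Y) * v)
  mul : ∀ (g h : CK) (u : NCPoly), T (g * h) u = T g (T h u)
  coproduct : ∀ (f : CK) (u w : NCPoly), u = X ∨ u = Y →
    T f (u * w) =
      LinearMap.mul' ℚ NCPoly (TensorProduct.map (T.flip u) (T.flip w) (coproduct f))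

/-- Auxiliary operator: `1 ↦ 0`, `x v ↦ x v`, `y v ↦ (x + 2 y) v`. -/
noncomputable def mapGraft : NCPoly →ₗ[ℚ] NCPoly :=
  onWords fun l => match l with
    | [] => 0
    | .x :: l => X * word l
    | .y :: l => (X + 2 * Y) * word l

theorem mapGraft_x (a : NCPoly) : mapGraft (X * a) = X * a := by
  have : mapGraft ∘ₗ LinearMap.mulLeft ℚ X = LinearMap.mulLeft ℚ X := linearMap_ext_word fun l => by
    simp only [LinearMap.comp_apply, LinearMap.mulLeft_apply]
    rw [← word_x, mapGraft, onWords_word, word_x]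
  exact congrArg (fun φ => φ a) this

theorem mapGraft_y (a : NCPoly) : mapGraft (Y * a) = (X + 2 * Y) * a := by
  have : mapGraft ∘ₗ LinearMap.mulLeft ℚ Y = LinearMap.mulLeft ℚ (X + 2 * Y) := linearMap_ext_word fun l => by
    simp only [LinearMap.comp_apply, LinearMap.mulLeft_apply]
    rw [← word_y, mapGraft, onWords_word]
  exact congrArg (fun φ => φ a) this

theorem mapGraft_z (a : NCPoly) : mapGraft ((X + Y) * a) = 2 * ((X + Y) * a) := by
  rw [add_mul, map_add, mapGraft_x, mapGraft_y]
  noncomm_ring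

/-- Auxiliary predicate: no constant term. -/
def NoConst (a : NCPoly) : Prop := ∃ b c, a = (X + Y) * b + X * c

theorem NoConst.add {a b : NCPoly} (ha : NoConst a) (hb : NoConst b) : NoConst (a + b) := by
  obtain ⟨p, q, rfl⟩ := ha
  obtain ⟨r, s, rfl⟩ := hb
  exact ⟨p + r, q + s, by rw [mul_add, mul_add]; abel⟩

theorem NoConst.smul {a : NCPoly} (c : ℚ) (ha : NoConst a) : NoConst (c • a) := by
  obtain ⟨p, q, rfl⟩ := ha
  exact ⟨c • p, c • q, by rw [smul_add, mul_smul_comm, mul_smul_comm]⟩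

theorem noConst_x (a : NCPoly) : NoConst (X * a) := ⟨0, a, by simp⟩

theorem noConst_z (a : NCPoly) : NoConst ((X + Y) * a) := ⟨a, 0, by simp⟩

theorem noConst_y (a : NCPoly) : NoConst (Y * a) := ⟨a, -a, by noncomm_ring⟩

theorem mapGraft_mul {a : NCPoly} (ha : NoConst a) (b : NCPoly) :
    mapGraft (a * b) = mapGraft a * b := by
  obtain ⟨p, q, rfl⟩ := ha
  simp only [add_mul _ _ b, map_add, mul_assoc, mapGraft_x, mapGraft_z]

/-- The values of `mapStep p` on words. -/
noncomputable def mapStepWord (p : Module.End ℚ NCPoly) : List Letter → NCPoly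
  | [] => 0
  | .x :: l => X * mapStepWord p l + Y * mapGraft (p (X * word l))
  | .y :: l => Y * mapStepWord p l - Y * mapGraft (p (X * word l))

/-- Auxiliary operator, which takes the rooted tree map of a forest `f` to that of `B₊(f)`. -/
noncomputable def mapStep (p : Module.End ℚ NCPoly) : Module.End ℚ NCPoly :=
  onWords (mapStepWord p)

section mapStep

variable (p : Module.End ℚ NCPoly)

theorem mapStep_one : mapStep p 1 = 0 := by
  rw [mapStep, ← word_nil, onWords_word, mapStepWord]

theorem mapStep_x (a : NCPoly) :
    mapStep p (X * a) = X * mapStep p a + Y * mapGraft (p (X * a)) := by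
  have : mapStep p ∘ₗ LinearMap.mulLeft ℚ X = LinearMap.mulLeft ℚ X ∘ₗ mapStep p + LinearMap.mulLeft ℚ Y ∘ₗ mapGraft ∘ₗ p ∘ₗ LinearMap.mulLeft ℚ X :=
    linearMap_ext_word fun l => by
      simp only [LinearMap.comp_apply, LinearMap.mulLeft_apply, LinearMap.add_apply]
      rw [← word_x, mapStep, onWords_word, onWords_word, mapStepWord, word_x]
  exact congrArg (fun φ => φ a) this

theorem mapStep_y (a : NCPoly) :
    mapStep p (Y * a) = Y * mapStep p a - Y * mapGraft (p (X * a)) := by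
  have : mapStep p ∘ₗ LinearMap.mulLeft ℚ Y = LinearMap.mulLeft ℚ Y ∘ₗ mapStep p - LinearMap.mulLeft ℚ Y ∘ₗ mapGraft ∘ₗ p ∘ₗ LinearMap.mulLeft ℚ X :=
    linearMap_ext_word fun l => by
      simp only [LinearMap.comp_apply, LinearMap.mulLeft_apply, LinearMap.sub_apply]
      rw [← word_y, mapStep, onWords_word, onWords_word, mapStepWord]
  exact congrArg (fun φ => φ a) this

theorem mapStep_z (a : NCPoly) : mapStep p ((X + Y) * a) = (X + Y) * mapStep p a := by
  rw [add_mul, map_add, mapStep_x, mapStep_y, add_mul]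
  abel

theorem eq_mapStep {s : Module.End ℚ NCPoly} (h1 : s 1 = 0)
    (hx : ∀ a, s (X * a) = X * s a + Y * mapGraft (p (X * a)))
    (hy : ∀ a, s (Y * a) = Y * s a - Y * mapGraft (p (X * a))) : s = mapStep p := by
  refine linearMap_ext_word fun l => ?_
  induction l with
  | nil => rw [word_nil, h1, mapStep_one]
  | cons c l ih =>
    cases c with
    | x => rw [word_x, hx, mapStep_x, ih]
    | y => rw [word_y, hy, mapStep_y, ih]

end mapStep

/-- Auxiliary predicate: compatible with left multiplication by `x + y`, and no constant terms. -/
def Good (p : Module.End ℚ NCPoly) : Prop :=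
  (∀ a, p ((X + Y) * a) = (X + Y) * p a) ∧ ∀ a, NoConst (p (X * a))

theorem good_one : Good 1 := ⟨fun _ => rfl, fun a => noConst_x a⟩

theorem Good.mul {p q : Module.End ℚ NCPoly} (hp : Good p) (hq : Good q) : Good (p * q) := by
  refine ⟨fun a => ?_, fun a => ?_⟩
  · rw [Module.End.mul_apply, hq.1, hp.1]; rfl
  · obtain ⟨b, c, h⟩ := hq.2 a
    rw [Module.End.mul_apply, h, map_add, hp.1]
    exact (noConst_z _).add (hp.2 c)

theorem Good.step {p : Module.End ℚ NCPoly} : Good (mapStep p) := by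
  refine ⟨mapStep_z p, fun a => ?_⟩
  rw [mapStep_x]
  exact (noConst_x _).add (noConst_y _)

theorem mapStep_graft {p : Module.End ℚ NCPoly} (hp : Good p) {a : NCPoly} (ha : NoConst a) :
    mapStep p (Y * mapGraft a) = Y * mapGraft (mapStep p a) +
      Y * mapGraft (p (Y * mapGraft a)) - 2 * (Y * ((X + Y) * p a)) -
      Y * ((X + Y) * mapGraft (p a)) := by
  obtain ⟨b, c, rfl⟩ := ha
  have hyz : ∀ v : NCPoly, Y * v = (X + Y) * v - X * v := fun v => by rw [add_mul]; abel
  have h1 : ∀ v : NCPoly, p (Y * v) = (X + Y) * p v - p (X * v) := fun v => by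
    rw [hyz, map_sub, hp.1]
  have two : ∀ (q : Module.End ℚ NCPoly) (v : NCPoly), q (2 * v) = 2 * q v := fun q v => by
    rw [two_mul, two_mul, map_add]
  simp only [map_add, mapGraft_x, mapGraft_z, mul_add Y, mapStep_y, mapStep_x, mapStep_z, h1,
    hp.1, two, mapGraft_y, map_sub]
  noncomm_ring

theorem commute_step {p q : Module.End ℚ NCPoly} (hp : Good p) (hq : Good q)
    (hpq : Commute p q) (hpt : Commute p (mapStep q)) (hsq : Commute (mapStep p) q) :
    Commute (mapStep p) (mapStep q) := by
  have e1 : ∀ a, p (q a) = q (p a) := fun a => congrArg (fun φ => φ a) hpq.eq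
  have e2 : ∀ a, p (mapStep q a) = mapStep q (p a) := fun a => congrArg (fun φ => φ a) hpt.eq
  have e3 : ∀ a, mapStep p (q a) = q (mapStep p a) := fun a => congrArg (fun φ => φ a) hsq.eq
  refine LinearMap.ext fun a => ?_
  simp only [Module.End.mul_apply]
  induction a using word_induction with
  | h1 => simp only [mapStep_one, map_zero]
  | hadd a b ha hb => simp only [map_add, ha, hb]
  | hsmul c a ha => simp only [map_smul, ha]
  | hz a ha => simp only [mapStep_z, ha]
  | hx a ha =>
    have k1 : X * mapStep q a = mapStep q (X * a) - Y * mapGraft (q (X * a)) := by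
      rw [mapStep_x]; abel
    have k2 : X * mapStep p a = mapStep p (X * a) - Y * mapGraft (p (X * a)) := by
      rw [mapStep_x]; abel
    rw [mapStep_x q a, mapStep_x p a, map_add, map_add, mapStep_x p, mapStep_x q, k1, k2,
      mapStep_graft hp (hq.2 a), mapStep_graft hq (hp.2 a), ha]
    simp only [map_sub, e2, e1, ← e3, mul_sub]
    abel

theorem good_fold (t : PlaneTree) : Good (t.fold mapStep) := by
  cases t with | node l =>
  rw [PlaneTree.fold]
  exact Good.step

theorem good_fold_prod (l : List PlaneTree) : Good (l.map (PlaneTree.fold mapStep)).prod := by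
  induction l with
  | nil => exact good_one
  | cons t l ih =>
    rw [List.map_cons, List.prod_cons]
    exact (good_fold t).mul ih

theorem commute_fold (s t : PlaneTree) : Commute (s.fold mapStep) (t.fold mapStep) := by
  induction s using PlaneTree.induction generalizing t with
  | h l ihl =>
    induction t using PlaneTree.induction with
    | h m ihm =>
      have hl : ∀ t : PlaneTree, Commute (l.map (PlaneTree.fold mapStep)).prod
          (t.fold mapStep) := by
        intro t
        refine Commute.list_prod_left _ _ fun x hx => ?_
        obtain ⟨s, hs, rfl⟩ := List.mem_map.1 hx
        exact ihl s hs t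
      have hm : Commute ((PlaneTree.node l).fold mapStep)
          (m.map (PlaneTree.fold mapStep)).prod := by
        refine Commute.list_prod_right _ _ fun x hx => ?_
        obtain ⟨t, ht, rfl⟩ := List.mem_map.1 hx
        exact ihm t ht
      have hlm : Commute (l.map (PlaneTree.fold mapStep)).prod
          (m.map (PlaneTree.fold mapStep)).prod := by
        refine Commute.list_prod_right _ _ fun x hx => ?_
        obtain ⟨t, _, rfl⟩ := List.mem_map.1 hx
        exact hl t
      have hlt := hl (.node m)
      rw [PlaneTree.fold] at hm hlt ⊢
      rw [PlaneTree.fold]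
      exact commute_step (good_fold_prod l) (good_fold_prod m) hlm hlt hm

/-- Auxiliary map: `f' ⊗ f'' ↦ f̃'(u) f̃''(w)`. -/
noncomputable def pairing (T : CK →ₗ[ℚ] NCPoly →ₗ[ℚ] NCPoly) (u w : NCPoly) :
    CK ⊗[ℚ] CK →ₗ[ℚ] NCPoly :=
  LinearMap.mul' ℚ NCPoly ∘ₗ TensorProduct.map (T.flip u) (T.flip w)

theorem pairing_tmul (T : CK →ₗ[ℚ] NCPoly →ₗ[ℚ] NCPoly) (u w : NCPoly) (g h : CK) :
    pairing T u w (g ⊗ₜ h) = T g u * T h w := by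
  simp [pairing]

theorem pairing_coproduct_graft (T : CK →ₗ[ℚ] NCPoly →ₗ[ℚ] NCPoly)
    (h0 : T (ofForest 0) = LinearMap.id) (u w : NCPoly) (f : Forest) :
    pairing T u w (coproduct (ofForest {graft f})) = u * T (ofForest {graft f}) w +
      pairing T u w (TensorProduct.map Bplus LinearMap.id (coproduct (ofForest f))) := by
  rw [isCoproduct_coproduct f, map_add, pairing_tmul, ← ofForest_zero, h0, LinearMap.id_apply]

theorem pairing_Bplus (T : CK →ₗ[ℚ] NCPoly →ₗ[ℚ] NCPoly) (u : NCPoly)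
    (hT : ∀ h, T (Bplus h) u = Y * mapGraft (T h u)) (hc : ∀ h, NoConst (T h u)) (w : NCPoly)
    (d : CK ⊗[ℚ] CK) : pairing T u w (TensorProduct.map Bplus LinearMap.id d) =
      Y * mapGraft (pairing T u w d) := by
  induction d using TensorProduct.induction_on with
  | zero => simp
  | tmul g h =>
    rw [TensorProduct.map_tmul, pairing_tmul, pairing_tmul, mapGraft_mul (hc g), hT, mul_assoc]
    rfl
  | add a b ha hb => simp only [map_add, ha, hb, mul_add]

theorem isRootedTreeMap_step {T : CK →ₗ[ℚ] NCPoly →ₗ[ℚ] NCPoly} (h : IsRootedTreeMap T)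
    (f : Forest) : T (ofForest {graft f}) = mapStep (T (ofForest f)) := by
  have hx1 : ∀ f, T (ofForest {graft f}) X = Y * mapGraft (T (ofForest f) X) := by
    intro f
    by_cases hf : f = 0
    · rw [hf, h.single_x, h.empty, LinearMap.id_apply, ← mul_one X, mapGraft_x]
    · obtain ⟨v, hv, hv'⟩ := h.graft f hf X (.inl rfl)
      rw [hv', hv, mapGraft_y]
  have hz : ∀ f : Forest, f ≠ 0 → T (ofForest f) (X + Y) = 0 := by
    intro f
    induction f using Forest.induction with
    | h0 => intro h; exact absurd rfl h
    | hg f ih =>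
      intro _
      by_cases hf : f = 0
      · rw [hf, map_add, h.single_x, h.single_y, add_neg_cancel]
      · obtain ⟨v, hv, hv'⟩ := h.graft f hf Y (.inr rfl)
        have e : T (ofForest {RootedTrees.graft f}) Y = Y * mapGraft (T (ofForest f) Y) := by
          rw [hv', hv, mapGraft_y]
        rw [map_add, hx1, e, ← mul_add, ← map_add, ← map_add, ih hf, map_zero, mul_zero]
    | hadd f g hf hg =>
      intro hfg
      rw [ofForest_add, h.mul]
      by_cases hg0 : g = 0
      · by_cases hf0 : f = 0
        · exact absurd (by rw [hf0, hg0, add_zero]) hfg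
        · rw [hg0, h.empty, LinearMap.id_apply, hf hf0]
      · rw [hg hg0, map_zero]
  have hcx : ∀ a : CK, NoConst (T a X) := by
    intro a
    induction a using ofForest_induction with
    | hf f =>
      by_cases hf : f = 0
      · rw [hf, h.empty, LinearMap.id_apply, ← mul_one X]
        exact noConst_x 1
      · obtain ⟨v, hv, _⟩ := h.graft f hf X (.inl rfl)
        rw [hv]
        exact noConst_y v
    | hadd a b ha hb => rw [map_add]; exact ha.add hb
    | hsmul c a ha => rw [map_smul]; exact ha.smul c
  have hBx : ∀ a, T (Bplus a) X = Y * mapGraft (T a X) := by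
    intro a
    induction a using ofForest_induction with
    | hf f => rw [Bplus_ofForest, hx1]
    | hadd a b ha hb => simp only [map_add, LinearMap.add_apply, ha, hb, mul_add]
    | hsmul c a ha => simp only [map_smul, LinearMap.smul_apply, ha, mul_smul_comm]
  have hBy : ∀ a, T (Bplus a) Y = -T (Bplus a) X := by
    intro a
    induction a using ofForest_induction with
    | hf f =>
      have := hz {graft f} (Multiset.singleton_ne_zero _)
      rw [map_add] at this
      rw [Bplus_ofForest]
      exact (neg_eq_of_add_eq_zero_right this).symm
    | hadd a b ha hb => simp only [map_add, LinearMap.add_apply, ha, hb, neg_add]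
    | hsmul c a ha => simp only [map_smul, LinearMap.smul_apply, ha, smul_neg]
  have hpy : ∀ (w : NCPoly) (d : CK ⊗[ℚ] CK),
      pairing T Y w (TensorProduct.map Bplus LinearMap.id d) =
        -pairing T X w (TensorProduct.map Bplus LinearMap.id d) := by
    intro w d
    induction d using TensorProduct.induction_on with
    | zero => simp
    | tmul a b =>
      rw [TensorProduct.map_tmul, pairing_tmul, pairing_tmul, hBy, neg_mul]
    | add a b ha hb => simp only [map_add, ha, hb, neg_add]
  have hcop : ∀ (f : Forest) (u w : NCPoly), u = X ∨ u = Y →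
      T (ofForest f) (u * w) = pairing T u w (coproduct (ofForest f)) :=
    fun f u w hu => h.coproduct _ u w hu
  have hx : ∀ w, T (ofForest {graft f}) (X * w) =
      X * T (ofForest {graft f}) w + Y * mapGraft (T (ofForest f) (X * w)) := by
    intro w
    rw [hcop _ _ _ (.inl rfl), pairing_coproduct_graft T h.empty, pairing_Bplus T X hBx hcx,
      ← hcop _ _ _ (.inl rfl)]
  have hy : ∀ w, T (ofForest {graft f}) (Y * w) =
      Y * T (ofForest {graft f}) w - Y * mapGraft (T (ofForest f) (X * w)) := by
    intro w
    rw [hcop _ _ _ (.inr rfl), pairing_coproduct_graft T h.empty, hpy,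
      pairing_Bplus T X hBx hcx, ← hcop _ _ _ (.inl rfl), sub_eq_add_neg]
  have h1 : T (ofForest {graft f}) 1 = 0 := by
    have e := hx 1
    rw [mul_one, hx1, right_eq_add] at e
    exact (mul_eq_zero.1 e).resolve_left (FreeAlgebra.ι_ne_zero _)
  exact eq_mapStep _ h1 hx hy

theorem existsUnique_rootedTreeMap :
    ∃! T : CK →ₗ[ℚ] NCPoly →ₗ[ℚ] NCPoly, IsRootedTreeMap T := by
  obtain ⟨φ, hφ⟩ := exists_fold mapStep commute_fold
  let Θ : CK →ₐ[ℚ] Module.End ℚ NCPoly := AddMonoidAlgebra.lift ℚ _ _ φ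
  let T : CK →ₗ[ℚ] NCPoly →ₗ[ℚ] NCPoly := Θ.toLinearMap
  have hT : ∀ f, T (ofForest f) = φ (.ofAdd f) := fun f => by
    change Θ (ofForest f) = _
    simp [Θ, ofForest, AddMonoidAlgebra.lift_single]
  have h0 : T (ofForest 0) = LinearMap.id := (hT 0).trans (map_one φ)
  have hstep : ∀ f, T (ofForest {graft f}) = mapStep (T (ofForest f)) := fun f => by
    rw [hT, hφ, hT]
  have hmul : ∀ (g h : CK) (u : NCPoly), T (g * h) u = T g (T h u) := fun g h u =>
    congrArg (fun ψ : Module.End ℚ NCPoly => ψ u) (map_mul Θ g h)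
  have hgood : ∀ f, Good (T (ofForest f)) := by
    intro f
    induction f using Forest.induction with
    | h0 => rw [h0]; exact good_one
    | hg f _ => rw [hstep]; exact Good.step
    | hadd f g hf hg =>
      have : T (ofForest (f + g)) = (T (ofForest f) : Module.End ℚ NCPoly) * T (ofForest g) := by
        rw [ofForest_add]
        exact map_mul Θ _ _
      rw [this]
      exact hf.mul hg
  have hTz : ∀ (h : CK) (a : NCPoly), T h ((X + Y) * a) = (X + Y) * T h a := by
    intro h a
    induction h using ofForest_induction with
    | hf f => exact (hgood f).1 a
    | hadd b c hb hc => rw [map_add, LinearMap.add_apply, LinearMap.add_apply, hb, hc, mul_add]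
    | hsmul r b hb => rw [map_smul, LinearMap.smul_apply, LinearMap.smul_apply, hb, mul_smul_comm]
  have hTc : ∀ (h : CK) (a : NCPoly), NoConst (T h (X * a)) := by
    intro h a
    induction h using ofForest_induction with
    | hf f => exact (hgood f).2 a
    | hadd b c hb hc => rw [map_add]; exact hb.add hc
    | hsmul r b hb => rw [map_smul]; exact hb.smul r
  have hB1 : ∀ h, T (Bplus h) 1 = 0 := by
    intro h
    induction h using ofForest_induction with
    | hf f => rw [Bplus_ofForest, hstep, mapStep_one]
    | hadd b c hb hc => rw [map_add, map_add, LinearMap.add_apply, hb, hc, add_zero]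
    | hsmul r b hb => rw [map_smul, map_smul, LinearMap.smul_apply, hb, smul_zero]
  have hBx : ∀ h a, T (Bplus h) (X * a) = X * T (Bplus h) a + Y * mapGraft (T h (X * a)) := by
    intro h a
    induction h using ofForest_induction with
    | hf f => rw [Bplus_ofForest, hstep, mapStep_x]
    | hadd b c hb hc =>
      simp only [map_add, LinearMap.add_apply, hb, hc, mul_add]
      abel
    | hsmul r b hb =>
      simp only [map_smul, LinearMap.smul_apply, hb, mul_smul_comm, smul_add]
  have hcop : ∀ (f : Forest) (a b : NCPoly),
      T (ofForest f) (a * b) = pairing T a b (coproduct (ofForest f)) := by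
    intro f
    induction f using Forest.induction with
    | h0 =>
      intro a b
      rw [ofForest_zero, map_one coproduct, Algebra.TensorProduct.one_def, pairing_tmul, ← ofForest_zero, h0]
      rfl
    | hadd f g hf hg =>
      intro a b
      have hf' : ∀ d : CK ⊗[ℚ] CK, T (ofForest f) (pairing T a b d) =
          pairing T a b (coproduct (ofForest f) * d) := by
        intro d
        induction d using TensorProduct.induction_on with
        | zero => simp
        | add d e hd he => simp only [map_add, mul_add, hd, he]
        | tmul c d =>
          rw [pairing_tmul, hf]
          generalize coproduct (ofForest f) = e
          induction e using TensorProduct.induction_on with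
          | zero => simp
          | add p q hp hq => simp only [map_add, add_mul, hp, hq]
          | tmul p q =>
            rw [pairing_tmul, Algebra.TensorProduct.tmul_mul_tmul, pairing_tmul, hmul, hmul]
      rw [ofForest_add, hmul, hg, hf', map_mul coproduct]
    | hg f ih =>
      intro a b
      rw [pairing_coproduct_graft T h0]
      have ih' := fun a => ih a b
      generalize coproduct (ofForest f) = d at ih'
      induction a using word_induction with
      | h1 =>
        have : pairing T 1 b (TensorProduct.map Bplus LinearMap.id d) = 0 := by
          clear ih'
          induction d using TensorProduct.induction_on with
          | zero => simp
          | add p q hp hq => rw [map_add, map_add, hp, hq, add_zero]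
          | tmul p q => rw [TensorProduct.map_tmul, pairing_tmul, hB1, zero_mul]
        rw [this, one_mul, one_mul, add_zero]
      | hadd a c ha hc =>
        rw [add_mul, map_add, ha, hc]
        simp only [pairing, map_add, TensorProduct.map_add_left, LinearMap.comp_add,
          LinearMap.add_apply, add_mul]
        abel
      | hsmul r a ha =>
        rw [smul_mul_assoc, map_smul, ha]
        simp only [pairing, map_smul, TensorProduct.map_smul_left, LinearMap.comp_smul,
          LinearMap.smul_apply, smul_mul_assoc, smul_add]
      | hz a ha =>
        have : pairing T ((X + Y) * a) b (TensorProduct.map Bplus LinearMap.id d) =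
            (X + Y) * pairing T a b (TensorProduct.map Bplus LinearMap.id d) := by
          clear ih' ha
          induction d using TensorProduct.induction_on with
          | zero => simp
          | add p q hp hq => rw [map_add, map_add, hp, hq, map_add, mul_add]
          | tmul p q => rw [TensorProduct.map_tmul, pairing_tmul, pairing_tmul, hTz, mul_assoc]
        rw [this, mul_assoc, hTz, ha, mul_add, mul_assoc]
      | hx a ha =>
        have : pairing T (X * a) b (TensorProduct.map Bplus LinearMap.id d) =
            X * pairing T a b (TensorProduct.map Bplus LinearMap.id d) +
              Y * mapGraft (pairing T (X * a) b d) := by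
          clear ih' ha
          induction d using TensorProduct.induction_on with
          | zero => simp
          | add p q hp hq =>
            simp only [map_add, hp, hq, mul_add]
            abel
          | tmul p q =>
            simp only [TensorProduct.map_tmul, pairing_tmul, hBx, mapGraft_mul (hTc p a),
              LinearMap.id_apply, add_mul, mul_assoc]
        rw [this, ← ih', mul_assoc, hstep, mapStep_x, ← hstep, ha, mul_add, mul_assoc, add_assoc]
  have hY : ∀ f : Forest, (∀ v, ∃ v', T (ofForest f) (Y * v) = Y * v') ∧
      (f ≠ 0 → T (ofForest f) 1 = 0 ∧ ∃ v, T (ofForest f) X = Y * v) := by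
    intro f
    induction f using Forest.induction with
    | h0 => exact ⟨fun v => ⟨v, by rw [h0]; rfl⟩, fun h => absurd rfl h⟩
    | hg f ih =>
      rw [hstep]
      refine ⟨fun v => ⟨_, by rw [mapStep_y, ← mul_sub]⟩, fun _ => ⟨mapStep_one _, ?_⟩⟩
      exact ⟨mapGraft (T (ofForest f) X), by
        rw [← mul_one X, mapStep_x, mapStep_one, mul_zero, zero_add]⟩
    | hadd f g hf hg =>
      have e : ∀ a, T (ofForest (f + g)) a = T (ofForest f) (T (ofForest g) a) := fun a => by
        rw [ofForest_add, hmul]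
      refine ⟨fun v => ?_, fun hfg => ?_⟩
      · obtain ⟨v', h'⟩ := hg.1 v
        rw [e, h']
        exact hf.1 v'
      · by_cases hg0 : g = 0
        · have hf0 : f ≠ 0 := fun hf0 => hfg (by rw [hf0, hg0, add_zero])
          rw [hg0, add_zero]
          exact hf.2 hf0
        · obtain ⟨h1, v, hv⟩ := hg.2 hg0
          rw [e, e, h1, map_zero, hv]
          exact ⟨rfl, hf.1 v⟩
  have hgx : ∀ f, T (ofForest {graft f}) X = Y * mapGraft (T (ofForest f) X) := fun f => by
    rw [hstep, ← mul_one X, mapStep_x, mapStep_one, mul_zero, zero_add]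
  have hgy : ∀ f, T (ofForest {graft f}) Y = -(Y * mapGraft (T (ofForest f) X)) := fun f => by
    rw [hstep, ← mul_one Y, mapStep_y, mapStep_one, mul_zero, zero_sub, mul_one, mul_one]
  have hxy : ∀ f : Forest, f ≠ 0 → T (ofForest f) Y = -T (ofForest f) X := fun f hf => by
    have := hTz (ofForest f) 1
    rw [(hY f).2 hf |>.1, mul_zero, mul_one, map_add] at this
    exact (neg_eq_of_add_eq_zero_right this).symm
  refine ⟨T, ⟨h0, ?_, ?_, ?_, hmul, ?_⟩, ?_⟩
  · rw [hgx, h0, LinearMap.id_apply, ← mul_one X, mapGraft_x]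
  · rw [hgy, h0, LinearMap.id_apply, ← mul_one X, mapGraft_x]
  · intro f hf u hu
    obtain ⟨v, hv⟩ := ((hY f).2 hf).2
    rcases hu with rfl | rfl
    · exact ⟨v, hv, by rw [hgx, hv, mapGraft_y]⟩
    · exact ⟨-v, by rw [hxy f hf, hv, mul_neg], by rw [hgy, hv, mapGraft_y, mul_neg, mul_neg]⟩
  · intro f u w _
    change T f (u * w) = pairing T u w (coproduct f)
    induction f using ofForest_induction with
    | hf f => exact hcop f u w
    | hadd a b ha hb => rw [map_add, map_add, map_add, LinearMap.add_apply, ha, hb]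
    | hsmul c a ha => rw [map_smul, map_smul, map_smul, LinearMap.smul_apply, ha]
  · intro T' h'
    refine linearMap_ext_forest fun f => ?_
    induction f using Forest.induction with
    | h0 => rw [h'.empty, h0]
    | hg f ih => rw [isRootedTreeMap_step h', hstep, ih]
    | hadd f g hf hg =>
      refine LinearMap.ext fun a => ?_
      rw [ofForest_add, h'.mul, hmul, hf, hg]

/-- The rooted tree maps: `rootedTreeMap f` is the linear map `f̃` on `ℚ⟨x, y⟩`. -/
noncomputable def rootedTreeMap : CK →ₗ[ℚ] NCPoly →ₗ[ℚ] NCPoly :=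
  existsUnique_rootedTreeMap.choose

theorem isRootedTreeMap_rootedTreeMap : IsRootedTreeMap rootedTreeMap :=
  existsUnique_rootedTreeMap.choose_spec.1

end RootedTrees

/-!
On `ℚ⟨x, y⟩x` the map `f̃` should be the `⋄`-multiplication by `F_f`. Because `⋄` is associative,
this relation between operators and polynomials is compatible with the product rules for `f̃` and
`F_f`, so the point is the grafting `B₊`. There both sides of the relation obey the same recursion
on the left letters of the argument: they commute with the left multiplication by `x + y`, and they
acquire the same correction term when the argument is multiplied by `x`, because
`L_{x+2y} L_y⁻¹`, extended by the identity to `xℚ⟨x, y⟩`, maps `y v ⋄ x w` to `(x + 2 y) v ⋄ x w`.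
-/

namespace RootedTrees

/-- The elements of `ℚ + yℚ⟨x, y⟩`, the subspace that contains every `F_f` and on which
`polyGraft` is the grafting rule `F_f ↦ F_{B₊(f)}`. -/
def IsConstAddY (a : NCPoly) : Prop := ∃ (c : ℚ) (v : NCPoly), a = c • 1 + Y * v

theorem isConstAddY_one : IsConstAddY 1 := ⟨1, 0, by simp⟩

theorem isConstAddY_y (v : NCPoly) : IsConstAddY (Y * v) := ⟨0, v, by simp⟩

theorem IsConstAddY.noConst_diamond_x {a : NCPoly} (ha : IsConstAddY a) (w : NCPoly) :
    NoConst (diamond a (X * w)) := by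
  obtain ⟨c, v, rfl⟩ := ha
  simp only [map_add, map_smul, LinearMap.add_apply, LinearMap.smul_apply, one_diamond,
    diamond_y_x]
  exact ((noConst_x w).smul c).add ((noConst_y _).add (noConst_x _))

theorem IsConstAddY.polyGraft_mul_x {a : NCPoly} (ha : IsConstAddY a) :
    polyGraft a * X = Y * mapGraft (a * X) := by
  obtain ⟨c, v, rfl⟩ := ha
  have mapGraft_X : mapGraft X = X := by simpa using mapGraft_x 1
  simp only [map_add, map_smul, polyGraft_one, polyGraft_y, add_mul _ _ X, smul_mul_assoc,
    one_mul, mul_assoc, mapGraft_X, mapGraft_y, mul_add Y, mul_smul_comm]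

theorem mapGraft_diamond_y_x (v w : NCPoly) :
    mapGraft (diamond (Y * v) (X * w)) = diamond ((X + 2 * Y) * v) (X * w) := by
  have split_letter : (X + 2 * Y) * v = (X + Y) * v + Y * v := by noncomm_ring
  rw [split_letter, map_add, LinearMap.add_apply, z_diamond, diamond_y_x, map_add, mapGraft_x,
    mapGraft_y]
  noncomm_ring

theorem IsConstAddY.polyGraft_diamond_x {a : NCPoly} (ha : IsConstAddY a) (w : NCPoly) :
    diamond (polyGraft a) (X * w) =
      X * diamond (polyGraft a) w + Y * mapGraft (diamond a (X * w)) := by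
  obtain ⟨c, v, rfl⟩ := ha
  have const_case : diamond Y (X * w) = X * diamond Y w + Y * (X * w) := by
    simpa [one_diamond, add_comm] using diamond_y_x 1 w
  simp only [map_add, map_smul, LinearMap.add_apply, LinearMap.smul_apply, polyGraft_one,
    polyGraft_y, one_diamond, mapGraft_x, mapGraft_diamond_y_x, const_case,
    diamond_y_x ((X + 2 * Y) * v), mul_add, mul_smul_comm, smul_add]
  abel

/-- The relation to be proved between `p = f̃` and `a = F_f`: on `ℚ⟨x, y⟩x`, identified with
`ℚ⟨x, y⟩` by removing the last letter, `p` is the left `⋄`-multiplication by `a`. -/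
def ActsByDiamond (p : Module.End ℚ NCPoly) (a : NCPoly) : Prop :=
  ∀ w, p (w * X) = diamond a w * X

namespace ActsByDiamond

variable {p q : Module.End ℚ NCPoly} {a b : NCPoly}

theorem one : ActsByDiamond 1 1 := fun w => by rw [one_diamond, Module.End.one_apply]

theorem mul (hp : ActsByDiamond p a) (hq : ActsByDiamond q b) :
    ActsByDiamond (p * q) (diamond a b) := fun w => by
  rw [Module.End.mul_apply, hq, hp, diamond_assoc]

theorem add (hp : ActsByDiamond p a) (hq : ActsByDiamond q b) :
    ActsByDiamond (p + q) (a + b) := fun w => by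
  rw [LinearMap.add_apply, hp, hq, map_add, LinearMap.add_apply, add_mul]

theorem smul (c : ℚ) (hp : ActsByDiamond p a) : ActsByDiamond (c • p) (c • a) := fun w => by
  rw [LinearMap.smul_apply, hp, map_smul, LinearMap.smul_apply, smul_mul_assoc]

theorem mapStep (hp : ActsByDiamond p a) (ha : IsConstAddY a) :
    ActsByDiamond (mapStep p) (polyGraft a) := by
  intro w
  induction w using word_induction with
  | h1 =>
    calc RootedTrees.mapStep p (1 * X) = Y * mapGraft (p (1 * X)) := by
          simpa [mapStep_one] using mapStep_x p 1
      _ = Y * mapGraft (a * X) := by rw [hp, diamond_one]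
      _ = diamond (polyGraft a) 1 * X := by rw [diamond_one, ha.polyGraft_mul_x]
  | hadd v w hv hw => rw [add_mul, map_add, hv, hw, map_add, add_mul]
  | hsmul c w hw => rw [smul_mul_assoc, map_smul, hw, map_smul, smul_mul_assoc]
  | hz w hw => rw [mul_assoc, mapStep_z, hw, diamond_z, mul_assoc]
  | hx w hw =>
    calc RootedTrees.mapStep p (X * w * X)
        = X * RootedTrees.mapStep p (w * X) + Y * mapGraft (p (X * w * X)) := by
          rw [mul_assoc, mapStep_x]
      _ = X * (diamond (polyGraft a) w * X) + Y * (mapGraft (diamond a (X * w)) * X) := by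
          rw [hw, hp, mapGraft_mul (ha.noConst_diamond_x w)]
      _ = diamond (polyGraft a) (X * w) * X := by
          rw [ha.polyGraft_diamond_x, add_mul, mul_assoc, mul_assoc]

end ActsByDiamond

theorem IsTreePolynomial.isConstAddY {F : CK →ₗ[ℚ] NCPoly} (hF : IsTreePolynomial F)
    (f : Forest) : IsConstAddY (F (ofForest f)) := by
  by_cases hf : f = 0
  · rw [hf, hF.empty]
    exact isConstAddY_one
  · obtain ⟨v, hv, -⟩ := hF.graft f hf
    rw [hv]
    exact isConstAddY_y v

theorem IsTreePolynomial.graft_eq_polyGraft {F : CK →ₗ[ℚ] NCPoly} (hF : IsTreePolynomial F)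
    (f : Forest) :
    F (ofForest {RootedTrees.graft f}) = polyGraft (F (ofForest f)) := by
  by_cases hf : f = 0
  · rw [hf, hF.single, hF.empty, polyGraft_one]
  · obtain ⟨v, hv, hv'⟩ := hF.graft f hf
    rw [hv', hv, polyGraft_y]

theorem IsRootedTreeMap.actsByDiamond_ofForest {T : CK →ₗ[ℚ] NCPoly →ₗ[ℚ] NCPoly}
    {F : CK →ₗ[ℚ] NCPoly} (hT : IsRootedTreeMap T) (hF : IsTreePolynomial F) (f : Forest) :
    ActsByDiamond (T (ofForest f)) (F (ofForest f)) := by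
  induction f using Forest.induction with
  | h0 =>
    rw [hT.empty, hF.empty]
    exact .one
  | hg f ih =>
    rw [isRootedTreeMap_step hT, hF.graft_eq_polyGraft]
    exact ih.mapStep (hF.isConstAddY f)
  | hadd f g hf hg =>
    have T_add : T (ofForest (f + g)) = (T (ofForest f) * T (ofForest g) : Module.End ℚ NCPoly) :=
      LinearMap.ext fun u => by rw [ofForest_add, hT.mul, Module.End.mul_apply]
    rw [T_add, hF.mul]
    exact hf.mul hg

end RootedTrees

theorem theorem1 (f : RootedTrees.CK) (w : RootedTrees.NCPoly) :
    RootedTrees.rootedTreeMap f (w * RootedTrees.X) =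
      RootedTrees.diamond (RootedTrees.treePolynomial f) w * RootedTrees.X := by
  suffices h : RootedTrees.ActsByDiamond (RootedTrees.rootedTreeMap f)
      (RootedTrees.treePolynomial f) from h w
  induction f using RootedTrees.ofForest_induction with
  | hf f =>
    exact RootedTrees.isRootedTreeMap_rootedTreeMap.actsByDiamond_ofForest
      RootedTrees.isTreePolynomial_treePolynomial f
  | hadd a b ha hb =>
    rw [map_add, map_add]
    exact ha.add hb
  | hsmul c a ha =>
    rw [map_smul, map_smul]
    exact ha.smul c
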